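/- Let $K$ be an algebraically closed field and let $P(x,y,T)=p(x,y)-T\,x^{c}\,U(x,y)$ be a special pencil over $K[[x,y]]$: $c>0$, $U$ is a unit, $x\nmid p$ and $p(0,0)=0$. For $t\in K$ let $C_t$ be the curve $P(x,y,t)=0$. *Toric-Newton process.* The Newton polygon of $P$ consists of the compact faces of the convex hull of $\operatorname{supp}(P)+\mathbb N^2$, where $P$ is regarded as a power series in $x,y$ over $K(T)$. An edge $\ell$ lies on a line $ni+mj=\omega$ with $n,m$ positive and coprime, and the part of $P$ on $\ell$ is $P_\ell=x^{u}y^{v}q_\ell(x^{m},y^{n})$ with $q_\ell(s_1,s_2)$ homogeneous of degree $d_\ell\ge 1$ and prime to $s_1s_2$; $n$ is the v-ratio of $\ell$. The edge is dicritical if $(c,0)$ is a vertex of it. If $n=1$ and $P_\ell$ is proportional to $(y-Ax^{m})^{e}$ with $A\in K$, one replaces $y$ by $y+Ax^m$. For every other non-dicritical edge $\ell$ and every root $\alpha\in K$ of $q_\ell(1,s)$, one passes to the strict transform, which is $P\bigl(x_1^{n}(\bar y_1+\alpha)^{a},x_1^{m}(\bar y_1+\alpha)^{b},T\bigr)/x_1^{\omega}$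 up to a unit, where natural numbers $a,b$ with $bn-am=1$ have been fixed for each pair $(n,m)$. All the pencils so obtained are special, and one repeats the process with each of them. A *dicritical* $E$ of $P$ is a dicritical edge $\ell$ of the Newton polygon of one of the pencils $\tilde P=\tilde p-Tx^{\tilde c}\tilde U$ of the resulting tree (including $P$ itself), counted with its position in the tree. Its v-ratio is that of $\ell$, its degree is $d_E=d_\ell$, and its polynomial $q_E(z)\in K[z]$, of degree $d_E$, is given by $q_\ell(1,z)=\tilde U(0,0)\,(q_E(z)-T)$. *Atypical values.* In the toric chart $(x_1,y_1)\mapsto(x_1^{n}y_1^{a},x_1^{m}y_1^{b})$, $bn-am=1$ (with $(a,b)=(0,1)$ if $n=1$), $E$ is the curve $x_1=0$. The point $(0,\alpha)$ of $E$ is free, i.e. lies on no other component of the exceptional divisor, if $\alpha\neq0$ or $n=1$. A value $t\in K$ is *typical at $E$* if the strict transform of $C_t$ meets $E$ in exactly $d_E$ free points and is, at each of them, non-singular and transversal to $E$ (a curvette); otherwise $t$ is *atypical at $E$*. The value $t$ is atypical for $P$ if it is atypical at some dicritical. **Theorem.** Assume that the polynomial $q_E$ of every dicritical $E$ is separable,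 i.e. $q_E'\neq0$. For every dicritical $E$, with v-ratio $n$ and $A_E=\{q_E(\alpha)\mid \alpha\in K,\ q_E'(\alpha)=0\}$, the set of atypical values for $P$ at $E$ is $$\begin{cases}A_E\cup\{q_E(0)\}&\text{if } n>1,\\ A_E&\text{if } n=1.\end{cases}$$ In particular, the number of atypical values for $P$ at $E$ is at most $M_E:=\#\{\text{non-zero roots of } q_E'\}+1$. Moreover there are only finitely many dicriticals, and the number of atypical values for $P$ is at most $\sum_{E}M_E$, the sum being over all dicriticals of $P$. -/

import Mathlib

universe u

noncomputable section

/-- The series `p` and `U` and the exponent `c` of a pencil `P(x, y, T) = p - T x ^ c U`, where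
`K[[x, y]]` is `MvPowerSeries (Fin 2) K`, with `x` the variable `0` and `y` the variable `1`. -/
structure Pencil (K : Type u) [Field K] where
  p : MvPowerSeries (Fin 2) K
  c : ℕ
  U : MvPowerSeries (Fin 2) K

/-- The exponent `(i, j)` of the monomial `x ^ i y ^ j`. -/
def expo (i j : ℕ) : Fin 2 →₀ ℕ := Finsupp.single 0 i + Finsupp.single 1 j

/-- Quotient of `f` by `x ^ w`. It is only used for series `f` that are divisible by `x ^ w`. -/
def divX {K : Type u} [Field K] (w : ℕ) (f : MvPowerSeries (Fin 2) K) :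
    MvPowerSeries (Fin 2) K :=
  fun s => MvPowerSeries.coeff (s + expo w 0) f

theorem X_pow_mul_divX {K : Type u} [Field K] (w : ℕ) (f g : MvPowerSeries (Fin 2) K)
    (h : f = MvPowerSeries.X 0 ^ w * g) : divX w f = g := by
  ext s
  have h1 : MvPowerSeries.coeff s (divX w f) = MvPowerSeries.coeff (s + expo w 0) f := rfl
  rw [h1, h, MvPowerSeries.X_pow_eq, add_comm s]
  have : expo w 0 = Finsupp.single 0 w := by simp [expo]
  rw [this, MvPowerSeries.coeff_add_monomial_mul, one_mul]

/-- The germ at the point `(0, α)` of the toric map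
`(x₁, y₁) ↦ (x₁ ^ n y₁ ^ a, x₁ ^ m y₁ ^ b)`, in the coordinates `x₁` and `y₁ - α`. -/
def toricGerm {K : Type u} [Field K] (n m a b : ℕ) (α : K) : Fin 2 → MvPowerSeries (Fin 2) K :=
  ![MvPowerSeries.X 0 ^ n * (MvPowerSeries.X 1 + MvPowerSeries.C α) ^ a,
    MvPowerSeries.X 0 ^ m * (MvPowerSeries.X 1 + MvPowerSeries.C α) ^ b]

/-- The map `(x, y₁) ↦ (x, y₁ + A x ^ m)`. -/
def shear {K : Type u} [Field K] (m : ℕ) (A : K) : Fin 2 → MvPowerSeries (Fin 2) K :=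
  ![MvPowerSeries.X 0, MvPowerSeries.X 1 + MvPowerSeries.C A * MvPowerSeries.X 0 ^ m]

theorem hasSubst_toricGerm {K : Type u} [Field K] {n m : ℕ} (hn : 0 < n) (hm : 0 < m) (a b : ℕ)
    (α : K) : MvPowerSeries.HasSubst (toricGerm n m a b α) := by
  apply MvPowerSeries.hasSubst_of_constantCoeff_zero
  intro s
  fin_cases s <;> simp [toricGerm, hn.ne', hm.ne']

theorem hasSubst_shear {K : Type u} [Field K] {m : ℕ} (hm : 0 < m) (A : K) :
    MvPowerSeries.HasSubst (shear m A) := by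
  apply MvPowerSeries.hasSubst_of_constantCoeff_zero
  intro s
  fin_cases s <;> simp [shear, hm.ne']

/-- A choice, for all coprime positive `n` and `m`, of natural numbers `a` and `b` with
`b n - a m = 1`. -/
structure BezoutChoice where
  a : ℕ → ℕ → ℕ
  b : ℕ → ℕ → ℕ
  bezout : ∀ n m : ℕ, 0 < n → 0 < m → Nat.Coprime n m → b n m * n = a n m * m + 1

namespace Pencil

variable {K : Type u} [Field K]

/-- The pencil is special: `c > 0`, `U` is a unit, `x` does not divide `p`, and the origin is
a base point. -/
structure IsSpecial (P : Pencil K) : Prop where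
  c_pos : 0 < P.c
  isUnit_U : IsUnit P.U
  not_dvd : ¬ (MvPowerSeries.X 0 ∣ P.p)
  base_point : MvPowerSeries.constantCoeff P.p = 0

/-- `P(x, y, T)` as a power series in `x`, `y` with coefficients in `K[T]`. -/
def series (P : Pencil K) : MvPowerSeries (Fin 2) (Polynomial K) :=
  MvPowerSeries.map Polynomial.C P.p -
    MvPowerSeries.C Polynomial.X * MvPowerSeries.X 0 ^ P.c * MvPowerSeries.map Polynomial.C P.U

/-- The equation `P(x, y, t) = p - t x ^ c U` of the curve `C_t`. -/
def fibre (P : Pencil K) (t : K) : MvPowerSeries (Fin 2) K :=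
  P.p - MvPowerSeries.C t * MvPowerSeries.X 0 ^ P.c * P.U

/-- An edge `ℓ` (compact face of dimension one) of the Newton polygon of `P`. It is the
segment with end points `(u + m d, v)` and `(u, v + n d)`, on the supporting line
`n i + m j = n u + m v + n m d` with `n`, `m` positive and coprime. Thus the part of `P`
on the edge is `x ^ u y ^ v q (x ^ m, y ^ n)`, with `q` homogeneous of degree `d > 0` and prime
to both variables. The data are determined by the edge. -/
structure Edge (P : Pencil K) where
  n : ℕ
  m : ℕ
  u : ℕ
  v : ℕ
  d : ℕ
  n_pos : 0 < n
  m_pos : 0 < m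
  coprime : Nat.Coprime n m
  d_pos : 0 < d
  right_mem : MvPowerSeries.coeff (expo (u + m * d) v) P.series ≠ 0
  left_mem : MvPowerSeries.coeff (expo u (v + n * d)) P.series ≠ 0
  supporting : ∀ i j : ℕ, MvPowerSeries.coeff (expo i j) P.series ≠ 0 →
    n * u + m * v + n * m * d ≤ n * i + m * j
  endpoints : ∀ i j : ℕ, MvPowerSeries.coeff (expo i j) P.series ≠ 0 →
    n * i + m * j = n * u + m * v + n * m * d → u ≤ i ∧ v ≤ j

namespace Edge

variable {P : Pencil K}

/-- The value of the weight `n i + m j` on the edge. -/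
def weight (ℓ : Edge P) : ℕ := ℓ.n * ℓ.u + ℓ.m * ℓ.v + ℓ.n * ℓ.m * ℓ.d

/-- The polynomial `q_ℓ(1, s)`, with coefficients in `K[T]`. -/
def poly (ℓ : Edge P) : Polynomial (Polynomial K) :=
  ∑ k ∈ Finset.range (ℓ.d + 1),
    Polynomial.monomial k
      (MvPowerSeries.coeff (expo (ℓ.u + ℓ.m * (ℓ.d - k)) (ℓ.v + ℓ.n * k)) P.series)

/-- The edge is dicritical: `(c, 0)` is an end point of it. -/
def IsDicritical (ℓ : Edge P) : Prop := ℓ.v = 0 ∧ ℓ.u + ℓ.m * ℓ.d = P.c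

/-- The part of `P` on the edge is proportional to `(y - A x ^ m) ^ e`. -/
def IsPower (ℓ : Edge P) (A : K) : Prop :=
  ℓ.n = 1 ∧ ℓ.u = 0 ∧ ℓ.v = 0 ∧
    ∃ β : Polynomial K, ℓ.poly =
      Polynomial.C β * (Polynomial.X - Polynomial.C (Polynomial.C A)) ^ ℓ.d

/-- For a dicritical edge, the polynomial `q_E` such that
`q_ℓ(1, z) = U(0, 0) (q_E(z) - T)`; it is the restriction of `p / (x ^ c U)` to `E`. -/
def dicriticalPoly (ℓ : Edge P) : Polynomial K :=
  Polynomial.C (MvPowerSeries.constantCoeff P.U)⁻¹ * ℓ.poly.map (Polynomial.evalRingHom 0)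

end Edge

/-- The pencil after the change of variables `y = y₁ + A x ^ m`. -/
def translate (P : Pencil K) (m : ℕ) (A : K) : Pencil K where
  p := MvPowerSeries.subst (shear m A) P.p
  c := P.c
  U := MvPowerSeries.subst (shear m A) P.U

/-- The strict transform of `P` by the toric-Newton transformation of the edge `ℓ` (not
dicritical) and the root `α` of `q_ℓ(1, s)`: the pull-back of `P(x, y, T)` by
`(x₁ ^ n (y₁ + α) ^ a, x₁ ^ m (y₁ + α) ^ b)`, divided by the power `x₁ ^ w`, with `w` the weight of
the edge, of the equation `x₁` of the exceptional curve. Here `x ^ c U` becomes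
`x₁ ^ (n c) (y₁ + α) ^ (a c) U(...)`, and `w < n c`. -/
def strictTransform (P : Pencil K) (β : BezoutChoice) (ℓ : Edge P) (α : K) : Pencil K where
  p := divX ℓ.weight
    (MvPowerSeries.subst (toricGerm ℓ.n ℓ.m (β.a ℓ.n ℓ.m) (β.b ℓ.n ℓ.m) α) P.p)
  c := ℓ.n * P.c - ℓ.weight
  U := (MvPowerSeries.X 1 + MvPowerSeries.C α) ^ (β.a ℓ.n ℓ.m * P.c) *
    MvPowerSeries.subst (toricGerm ℓ.n ℓ.m (β.a ℓ.n ℓ.m) (β.b ℓ.n ℓ.m) α) P.U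

/-- The dicriticals of `P`, that is, the dicritical edges of the Newton polygons in the tree of
the toric-Newton process of `P`: either an edge of the polygon of `P` itself, or one that is found
after the change of variables `y = y₁ + A x ^ m`, when the polygon has an edge with polynomial
proportional to `(y - A x ^ m) ^ e`, or after the toric-Newton transformation of another
non-dicritical edge and of a root of its polynomial. A dicritical is recorded together with its
position in the tree. -/
inductive Dicritical (β : BezoutChoice) : Pencil K → Type u
  | here {P : Pencil K} (ℓ : Edge P) (h : ℓ.IsDicritical) : Dicritical β P
  | afterTranslation {P : Pencil K} (ℓ : Edge P) (A : K) (h : ℓ.IsPower A)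
      (E : Dicritical β (P.translate ℓ.m A)) : Dicritical β P
  | afterToric {P : Pencil K} (ℓ : Edge P) (h : ¬ ℓ.IsDicritical) (h' : ∀ A : K, ¬ ℓ.IsPower A)
      (α : K) (hα : ℓ.poly.eval (Polynomial.C α) = 0)
      (E : Dicritical β (P.strictTransform β ℓ α)) : Dicritical β P

namespace Dicritical

variable {β : BezoutChoice}

/-- The strict transform of the pencil whose Newton polygon carries the dicritical edge. -/
def pencil : {P : Pencil K} → Dicritical β P → Pencil K
  | P, .here _ _ => P
  | _, .afterTranslation _ _ _ E => E.pencil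
  | _, .afterToric _ _ _ _ _ E => E.pencil

/-- The dicritical edge. -/
def edge : {P : Pencil K} → (E : Dicritical β P) → Edge E.pencil
  | _, .here ℓ _ => ℓ
  | _, .afterTranslation _ _ _ E => E.edge
  | _, .afterToric _ _ _ _ _ E => E.edge

variable {P : Pencil K}

/-- The v-ratio `n` of `E`. -/
def vRatio (E : Dicritical β P) : ℕ := E.edge.n

/-- The degree `d_E` of `E`. -/
def degree (E : Dicritical β P) : ℕ := E.edge.d

/-- The polynomial `q_E`. -/
def q (E : Dicritical β P) : Polynomial K := E.edge.dicriticalPoly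

/-- The set `A_E` of critical values of `q_E`. -/
def criticalValues (E : Dicritical β P) : Set K :=
  {t | ∃ α : K, (Polynomial.derivative E.q).eval α = 0 ∧ E.q.eval α = t}

/-- The exponent `a` of the toric chart
`(x₁, y₁) ↦ (x₁ ^ n y₁ ^ a, x₁ ^ m y₁ ^ b)` in which `E` is `x₁ = 0`.
If `n = 1` it is the chart `(x₁, x₁ ^ m y₁)`, which shows the whole affine part of `E`. -/
def chartA (E : Dicritical β P) : ℕ := if E.edge.n = 1 then 0 else β.a E.edge.n E.edge.m

/-- The exponent `b` of the toric chart. -/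
def chartB (E : Dicritical β P) : ℕ := if E.edge.n = 1 then 1 else β.b E.edge.n E.edge.m

/-- The point `(0, α)` of `E` lies on no other component of the exceptional divisor. The axis
`y₁ = 0` of the chart is such another component exactly if `a` is positive. -/
def IsFreePoint (E : Dicritical β P) (α : K) : Prop := α ≠ 0 ∨ E.chartA = 0

/-- An equation of the germ at the point `(0, α)` of `E` of the strict transform of `C_t`, in the
coordinates `x₁` and `y₁ - α`. -/
def germ (E : Dicritical β P) (t α : K) : MvPowerSeries (Fin 2) K :=
  divX E.edge.weight
    (MvPowerSeries.subst (toricGerm E.edge.n E.edge.m E.chartA E.chartB α) (E.pencil.fibre t))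

end Dicritical

/-- The germ of curve `f = 0` passes through the origin. -/
def PassesThrough (f : MvPowerSeries (Fin 2) K) : Prop := MvPowerSeries.constantCoeff f = 0

/-- The germ of curve `f = 0` is a curvette of `x = 0`: it passes through the origin, is
non-singular there and is transversal to `x = 0`, i.e. the linear part of `f` is non-zero and
not a multiple of `x`. -/
def IsCurvette (f : MvPowerSeries (Fin 2) K) : Prop :=
  PassesThrough f ∧ MvPowerSeries.coeff (expo 0 1) f ≠ 0

namespace Dicritical

variable {β : BezoutChoice} {P : Pencil K}

/-- `t` is typical for `P` at `E`: the strict transform of `C_t` consists, along `E`, of exactly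
`d_E` non-singular curvettes, at distinct points of `E` (away from the other components
of the exceptional divisor). -/
def IsTypical (E : Dicritical β P) (t : K) : Prop :=
  (∀ α : K, E.IsFreePoint α → PassesThrough (E.germ t α) → IsCurvette (E.germ t α)) ∧
    {α : K | E.IsFreePoint α ∧ PassesThrough (E.germ t α)}.encard = E.degree

/-- The set of atypical values for `P` at `E`. -/
def atypicalValues (E : Dicritical β P) : Set K := {t | ¬ E.IsTypical t}

/-- The number `M_E = #{non-zero roots of q_E'} + 1`. -/
def bound (E : Dicritical β P) : ℕ∞ :=
  {α : K | α ≠ 0 ∧ (Polynomial.derivative E.q).eval α = 0}.encard + 1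

end Dicritical

/-- The set of atypical values for `P`: the values that are not typical at all dicriticals. -/
def atypicalValues (P : Pencil K) (β : BezoutChoice) : Set K :=
  {t | ¬ ∀ E : Dicritical β P, E.IsTypical t}

end Pencil

end

/-! ### Exponents of monomials in two variables. -/

section Expo

/-! Everything is read off on the exceptional curve. In a toric chart the monomial `x ^ i y ^ j`
becomes `x₁ ^ (n i + m j) y₁ ^ (a i + b j)`, so after division by `x₁ ^ ω` only the edge survives on
`x₁ = 0`. The relation `b n - a m = 1` turns consecutive points of the edge into consecutive powers
of `y₁`. For a dicritical edge, the germ of `C_t` at `(0, α)` therefore restricts to the Taylor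
expansion at `α` of `U(0, 0) y₁ ^ (a c) (q_E(y₁) - t)` (`coeff_germ`). At a free point the first two
factors are non-zero. Hence the curve passes through it iff `q_E(α) = t`, and is then a curvette iff
`q_E'(α) ≠ 0`.

Since `K` is algebraically closed, `q_E - t` has `d_E` roots with multiplicity. So `t` is typical
iff all of them are simple and free (`isTypical_iff`). The only point that may fail to be free is `α
= 0`, and it fails exactly when `n > 1`; this accounts for the extra value `q_E(0)`.

Finiteness of the tree (`Dicritical.finite`) is a lexicographic induction. A toric step lowers the
order in `y` of `p(0, y)` unless the edge is that of a power (`rootMultiplicity_lt`). A translation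
preserves this order and raises the order in `x` of `p(x, 0)`, while `c` stays fixed and bounds how
long this can matter. Each node has finitely many edges and roots. -/

@[simp]
theorem expo_apply_zero (i j : ℕ) : expo i j 0 = i := by simp [expo]

@[simp]
theorem expo_apply_one (i j : ℕ) : expo i j 1 = j := by simp [expo]

theorem expo_self (d : Fin 2 →₀ ℕ) : expo (d 0) (d 1) = d := by
  ext i
  fin_cases i <;> simp

theorem expo_inj {i j k l : ℕ} : expo i j = expo k l ↔ i = k ∧ j = l := by
  refine ⟨fun h => ⟨?_, ?_⟩, fun ⟨h, h'⟩ => by rw [h, h']⟩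
  · simpa using DFunLike.congr_fun h 0
  · simpa using DFunLike.congr_fun h 1

theorem expo_zero_zero : expo 0 0 = 0 := by simp [expo]

theorem expo_add (i j k l : ℕ) : expo i j + expo k l = expo (i + k) (j + l) := by
  ext s
  fin_cases s <;> simp

end Expo

/-! ### Coefficients of series pulled back by toric germs and shears. -/

section Coeff

variable {K : Type u} [Field K]

theorem X_pow_mul_X_pow (i j : ℕ) :
    (MvPowerSeries.X 0 ^ i * MvPowerSeries.X 1 ^ j : MvPowerSeries (Fin 2) K) =
      MvPowerSeries.monomial (expo i j) 1 := by
  rw [MvPowerSeries.X_pow_eq, MvPowerSeries.X_pow_eq, MvPowerSeries.monomial_mul_monomial, mul_one,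
    expo]

theorem coeff_expo_X_zero_mul (f : MvPowerSeries (Fin 2) K) (s : ℕ) :
    MvPowerSeries.coeff (expo 0 s) (MvPowerSeries.X 0 * f) = 0 := by
  classical
  rw [MvPowerSeries.X, MvPowerSeries.coeff_monomial_mul, if_neg]
  intro h
  simpa using h 0

theorem coeff_expo_X_one_mul (f : MvPowerSeries (Fin 2) K) (r : ℕ) :
    MvPowerSeries.coeff (expo r 0) (MvPowerSeries.X 1 * f) = 0 := by
  classical
  rw [MvPowerSeries.X, MvPowerSeries.coeff_monomial_mul, if_neg]
  intro h
  simpa using h 1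

theorem coeff_expo_X_pow_mul (f : MvPowerSeries (Fin 2) K) (c i j : ℕ) :
    MvPowerSeries.coeff (expo i j) (MvPowerSeries.X 0 ^ c * f) =
      if c ≤ i then MvPowerSeries.coeff (expo (i - c) j) f else 0 := by
  classical
  rw [MvPowerSeries.X_pow_eq, MvPowerSeries.coeff_monomial_mul, one_mul]
  have h : Finsupp.single 0 c ≤ expo i j ↔ c ≤ i := by
    refine ⟨fun h => by simpa using h 0, fun h s => ?_⟩
    fin_cases s <;> simp [h]
  have h' : expo i j - Finsupp.single 0 c = expo (i - c) j := by
    ext s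
    fin_cases s <;> simp
  simp only [h, h']

theorem coeff_expo_X_pow_mul_X_add_C_pow (k l r s : ℕ) (α : K) :
    MvPowerSeries.coeff (expo r s)
      (MvPowerSeries.X 0 ^ k * (MvPowerSeries.X 1 + MvPowerSeries.C α) ^ l) =
      if k = r then ((Polynomial.X + Polynomial.C α) ^ l).coeff s else 0 := by
  classical
  have h : ∀ i, (MvPowerSeries.X 0 ^ k * (MvPowerSeries.X 1 ^ i * MvPowerSeries.C α ^ (l - i) *
      (l.choose i : MvPowerSeries (Fin 2) K))) =
      MvPowerSeries.monomial (expo k i) (α ^ (l - i) * (l.choose i : K)) := by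
    intro i
    have h1 : (l.choose i : MvPowerSeries (Fin 2) K) = MvPowerSeries.C (l.choose i : K) := by simp
    rw [h1, mul_assoc, ← mul_assoc, X_pow_mul_X_pow, ← map_pow, ← map_mul,
      ← MvPowerSeries.monomial_zero_eq_C_apply, MvPowerSeries.monomial_mul_monomial, add_zero,
      one_mul]
  rw [add_pow, Finset.mul_sum, map_sum]
  simp only [h, MvPowerSeries.coeff_monomial, expo_inj, Polynomial.coeff_X_add_C_pow]
  split_ifs with hk
  · subst hk
    rw [Finset.sum_eq_single s]
    · simp
    · intro b _ hb
      simp [hb.symm]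
    · intro hs
      rw [Nat.choose_eq_zero_of_lt (by simpa using hs)]
      simp
  · refine Finset.sum_eq_zero fun i _ => if_neg fun h => hk h.1.symm

theorem coeff_expo_zero_shear (m : ℕ) (hm : 0 < m) (A : K) (i j s : ℕ) :
    MvPowerSeries.coeff (expo 0 s) (MvPowerSeries.X 0 ^ i *
      (MvPowerSeries.X 1 + MvPowerSeries.C A * MvPowerSeries.X 0 ^ m) ^ j) =
      if i = 0 ∧ j = s then 1 else 0 := by
  classical
  obtain ⟨m, rfl⟩ := Nat.exists_eq_succ_of_ne_zero hm.ne'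
  rcases i with _ | i
  -- As `m > 0`, the base is congruent to `y` modulo `x`, hence so are the `j`-th powers.
  · obtain ⟨g, hg⟩ := sub_dvd_pow_sub_pow
      (MvPowerSeries.X 1 + MvPowerSeries.C A * MvPowerSeries.X 0 ^ (m + 1) :
        MvPowerSeries (Fin 2) K) (MvPowerSeries.X 1) j
    rw [sub_eq_iff_eq_add] at hg
    have h : (MvPowerSeries.X 1 + MvPowerSeries.C A * MvPowerSeries.X 0 ^ (m + 1) :
        MvPowerSeries (Fin 2) K) ^ j =
        MvPowerSeries.X 0 * (MvPowerSeries.C A * MvPowerSeries.X 0 ^ m * g) +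
          MvPowerSeries.X 0 ^ 0 * MvPowerSeries.X 1 ^ j := by
      rw [hg]; ring
    rw [pow_zero, one_mul, h, map_add, coeff_expo_X_zero_mul, X_pow_mul_X_pow,
      MvPowerSeries.coeff_monomial, zero_add]
    simp [expo_inj, eq_comm]
  · rw [pow_succ', mul_assoc, coeff_expo_X_zero_mul]
    simp

theorem coeff_expo_shear_zero (m : ℕ) (A : K) (i j r : ℕ) :
    MvPowerSeries.coeff (expo r 0) (MvPowerSeries.X 0 ^ i *
      (MvPowerSeries.X 1 + MvPowerSeries.C A * MvPowerSeries.X 0 ^ m) ^ j) =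
      if i + m * j = r then A ^ j else 0 := by
  classical
  -- Now the congruence is modulo `y`: the `j`-th power reduces to `A ^ j x ^ (m j)`.
  obtain ⟨g, hg⟩ := sub_dvd_pow_sub_pow
    (MvPowerSeries.X 1 + MvPowerSeries.C A * MvPowerSeries.X 0 ^ m :
      MvPowerSeries (Fin 2) K) (MvPowerSeries.C A * MvPowerSeries.X 0 ^ m) j
  rw [sub_eq_iff_eq_add] at hg
  have h : MvPowerSeries.X 0 ^ i *
      (MvPowerSeries.X 1 + MvPowerSeries.C A * MvPowerSeries.X 0 ^ m :
      MvPowerSeries (Fin 2) K) ^ j =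
      MvPowerSeries.X 1 * (MvPowerSeries.X 0 ^ i * g) +
        MvPowerSeries.C (A ^ j) *
          (MvPowerSeries.X 0 ^ (i + m * j) * MvPowerSeries.X 1 ^ 0) := by
    rw [hg, map_pow]; ring
  rw [h, map_add, coeff_expo_X_one_mul, X_pow_mul_X_pow, MvPowerSeries.coeff_C_mul,
    MvPowerSeries.coeff_monomial, zero_add]
  simp [expo_inj, eq_comm]

theorem coeff_subst_toricGerm {n m : ℕ} (hn : 0 < n) (hm : 0 < m) (a b : ℕ) (α : K)
    (f : MvPowerSeries (Fin 2) K) (r s : ℕ) :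
    MvPowerSeries.coeff (expo r s) (MvPowerSeries.subst (toricGerm n m a b α) f) =
      ∑ᶠ d : Fin 2 →₀ ℕ, MvPowerSeries.coeff d f * (if n * d 0 + m * d 1 = r then
        ((Polynomial.X + Polynomial.C α) ^ (a * d 0 + b * d 1)).coeff s else 0) := by
  rw [MvPowerSeries.coeff_subst (hasSubst_toricGerm hn hm a b α)]
  refine finsum_congr fun d => ?_
  rw [← coeff_expo_X_pow_mul_X_add_C_pow, smul_eq_mul, Finsupp.prod_fintype _ _ (by simp),
    Fin.prod_univ_two]
  congr 2
  simp only [toricGerm, Matrix.cons_val_zero, Matrix.cons_val_one]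
  ring

theorem coeff_zero_subst_shear {m : ℕ} (hm : 0 < m) (A : K) (f : MvPowerSeries (Fin 2) K)
    (s : ℕ) : MvPowerSeries.coeff (expo 0 s) (MvPowerSeries.subst (shear m A) f) =
      MvPowerSeries.coeff (expo 0 s) f := by
  rw [MvPowerSeries.coeff_subst (hasSubst_shear hm A), finsum_eq_single _ (expo 0 s)]
  · rw [Finsupp.prod_fintype _ _ (by simp), Fin.prod_univ_two]
    simp only [shear, Matrix.cons_val_zero, Matrix.cons_val_one, coeff_expo_zero_shear m hm]
    simp
  · intro d hd
    rw [Finsupp.prod_fintype _ _ (by simp), Fin.prod_univ_two]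
    simp only [shear, Matrix.cons_val_zero, Matrix.cons_val_one, coeff_expo_zero_shear m hm]
    rw [if_neg, smul_zero]
    rintro ⟨h0, h1⟩
    exact hd (by rw [← expo_self d, h0, h1])

/-- On `y = 0` the shear and the chart `(x, x ^ m (y + A))` both restrict to `(x, A x ^ m)`. This
lets the results on edges in toric charts serve for translations too. -/
theorem coeff_subst_shear_zero {m : ℕ} (hm : 0 < m) (A : K) (f : MvPowerSeries (Fin 2) K)
    (r : ℕ) : MvPowerSeries.coeff (expo r 0) (MvPowerSeries.subst (shear m A) f) =
      MvPowerSeries.coeff (expo r 0) (MvPowerSeries.subst (toricGerm 1 m 0 1 A) f) := by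
  rw [MvPowerSeries.coeff_subst (hasSubst_shear hm A), coeff_subst_toricGerm one_pos hm]
  refine finsum_congr fun d => ?_
  rw [Finsupp.prod_fintype _ _ (by simp), Fin.prod_univ_two]
  simp only [shear, Matrix.cons_val_zero, Matrix.cons_val_one, coeff_expo_shear_zero,
    Polynomial.coeff_X_add_C_pow, smul_eq_mul]
  simp

theorem constantCoeff_subst_toricGerm {n m : ℕ} (hn : 0 < n) (hm : 0 < m) (a b : ℕ) (α : K)
    (f : MvPowerSeries (Fin 2) K) :
    MvPowerSeries.constantCoeff (MvPowerSeries.subst (toricGerm n m a b α) f) =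
      MvPowerSeries.constantCoeff f := by
  rw [← MvPowerSeries.coeff_zero_eq_constantCoeff_apply, ← expo_zero_zero,
    coeff_subst_toricGerm hn hm, finsum_eq_single _ 0]
  · simp
  · intro d hd
    rw [if_neg, mul_zero]
    intro h
    apply hd
    rw [← expo_self d]
    have h0 : d 0 = 0 := by
      by_contra h0
      have := Nat.mul_pos hn (Nat.pos_of_ne_zero h0)
      omega
    have h1 : d 1 = 0 := by
      by_contra h1
      have := Nat.mul_pos hm (Nat.pos_of_ne_zero h1)
      omega
    rw [h0, h1, expo_zero_zero]

end Coeff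

/-! ### The coefficients of a special pencil and their dependence on `T`. -/

namespace Pencil

variable {K : Type u} [Field K]

section Series

theorem map_evalRingHom_series (P : Pencil K) (t : K) :
    MvPowerSeries.map (Polynomial.evalRingHom t) P.series = P.fibre t := by
  have h : ∀ f : MvPowerSeries (Fin 2) K,
      MvPowerSeries.map (Polynomial.evalRingHom t) (MvPowerSeries.map Polynomial.C f) = f := by
    intro f
    ext s
    simp
  simp [series, fibre, h]

theorem coeff_fibre (P : Pencil K) (t : K) (s : Fin 2 →₀ ℕ) :
    MvPowerSeries.coeff s (P.fibre t) = (MvPowerSeries.coeff s P.series).eval t := by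
  rw [← map_evalRingHom_series, MvPowerSeries.coeff_map, Polynomial.coe_evalRingHom]

theorem fibre_zero (P : Pencil K) : P.fibre 0 = P.p := by simp [fibre]

theorem coeff_series_ne_zero {P : Pencil K} {t : K} {s : Fin 2 →₀ ℕ}
    (h : MvPowerSeries.coeff s (P.fibre t) ≠ 0) : MvPowerSeries.coeff s P.series ≠ 0 := by
  rw [coeff_fibre] at h
  intro h0
  simp [h0] at h

theorem coeff_series (P : Pencil K) (i j : ℕ) :
    MvPowerSeries.coeff (expo i j) P.series =
      Polynomial.C (MvPowerSeries.coeff (expo i j) P.p) - Polynomial.X * Polynomial.C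
        (if P.c ≤ i then MvPowerSeries.coeff (expo (i - P.c) j) P.U else 0) := by
  have h : MvPowerSeries.C Polynomial.X * MvPowerSeries.X 0 ^ P.c *
      MvPowerSeries.map Polynomial.C P.U =
      MvPowerSeries.C Polynomial.X *
        MvPowerSeries.map Polynomial.C (MvPowerSeries.X 0 ^ P.c * P.U) := by
    simp [mul_assoc]
  rw [series, h, map_sub, MvPowerSeries.coeff_C_mul, MvPowerSeries.coeff_map,
    MvPowerSeries.coeff_map, coeff_expo_X_pow_mul]

theorem coeff_series_of_lt (P : Pencil K) {i : ℕ} (h : i < P.c) (j : ℕ) :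
    MvPowerSeries.coeff (expo i j) P.series =
      Polynomial.C (MvPowerSeries.coeff (expo i j) P.p) := by
  rw [coeff_series, if_neg (not_le.2 h)]
  simp

theorem coeff_series_c (P : Pencil K) :
    MvPowerSeries.coeff (expo P.c 0) P.series =
      Polynomial.C (MvPowerSeries.coeff (expo P.c 0) P.p) - Polynomial.X * Polynomial.C
        (MvPowerSeries.constantCoeff P.U) := by
  rw [coeff_series, if_pos le_rfl, Nat.sub_self, expo_zero_zero,
    MvPowerSeries.coeff_zero_eq_constantCoeff_apply]

theorem IsSpecial.constantCoeff_U_ne_zero {P : Pencil K} (hP : P.IsSpecial) :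
    MvPowerSeries.constantCoeff P.U ≠ 0 :=
  (hP.isUnit_U.map MvPowerSeries.constantCoeff).ne_zero

/-- The coefficient of `T` in it is `-U(0, 0)`. The point `(c, 0)` in the support bounds all edges
on the right. -/
theorem IsSpecial.coeff_series_c_ne_zero {P : Pencil K} (hP : P.IsSpecial) :
    MvPowerSeries.coeff (expo P.c 0) P.series ≠ 0 := by
  rw [coeff_series_c]
  intro h
  have h1 := congrArg (fun f => Polynomial.coeff f 1) h
  simp [Polynomial.coeff_C, hP.constantCoeff_U_ne_zero] at h1

theorem IsSpecial.exists_coeff_ne_zero {P : Pencil K} (hP : P.IsSpecial) :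
    ∃ e, MvPowerSeries.coeff (expo 0 e) P.p ≠ 0 := by
  by_contra! h
  apply hP.not_dvd
  rw [MvPowerSeries.X_dvd_iff]
  intro s hs
  rw [← expo_self s, hs, h]

theorem not_X_dvd {f : MvPowerSeries (Fin 2) K} {e : ℕ}
    (h : MvPowerSeries.coeff (expo 0 e) f ≠ 0) : ¬ (MvPowerSeries.X 0 ∣ f) := by
  rintro ⟨g, rfl⟩
  exact h (coeff_expo_X_zero_mul g e)

end Series

/-! ### Edges of the Newton polygon and their polynomials. -/

namespace Edge

variable {P : Pencil K}

/-- Coprimality of `n` and `m` makes the lattice points of the edge follow each other by steps `(-m,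
n)`. -/
theorem exists_index (ℓ : Edge P) {i j : ℕ}
    (h : MvPowerSeries.coeff (expo i j) P.series ≠ 0) (hw : ℓ.n * i + ℓ.m * j = ℓ.weight) :
    ∃ k ≤ ℓ.d, i = ℓ.u + ℓ.m * (ℓ.d - k) ∧ j = ℓ.v + ℓ.n * k := by
  obtain ⟨hu, hv⟩ := ℓ.endpoints i j h hw
  obtain ⟨i, rfl⟩ := Nat.exists_eq_add_of_le hu
  obtain ⟨j, rfl⟩ := Nat.exists_eq_add_of_le hv
  have h1 : ℓ.n * i + ℓ.m * j = ℓ.n * (ℓ.m * ℓ.d) := by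
    rw [weight] at hw
    linarith
  obtain ⟨k, rfl⟩ : ℓ.n ∣ j := by
    refine ℓ.coprime.dvd_of_dvd_mul_left ?_
    rw [← Nat.dvd_add_right (Dvd.intro i rfl), h1]
    exact Dvd.intro _ rfl
  have h2 : i + ℓ.m * k = ℓ.m * ℓ.d :=
    Nat.eq_of_mul_eq_mul_left ℓ.n_pos (by linarith)
  have hk : k ≤ ℓ.d := Nat.le_of_mul_le_mul_left (by omega) ℓ.m_pos
  refine ⟨k, hk, ?_, rfl⟩
  rw [Nat.mul_sub]
  omega

theorem weight_le (hP : P.IsSpecial) (ℓ : Edge P) : ℓ.weight ≤ ℓ.n * P.c := by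
  simpa [weight] using ℓ.supporting _ _ hP.coeff_series_c_ne_zero

theorem weight_lt (hP : P.IsSpecial) (ℓ : Edge P) (h : ¬ ℓ.IsDicritical) :
    ℓ.weight < ℓ.n * P.c := by
  -- Equality would put `(c, 0)` on the supporting line, and a point of height zero there must be
  -- the right end of the edge.
  refine lt_of_le_of_ne (ℓ.weight_le hP) fun hw => h ?_
  obtain ⟨-, hv⟩ := ℓ.endpoints _ _ hP.coeff_series_c_ne_zero
    (by rw [mul_zero, add_zero, ← hw, weight])
  have hv : ℓ.v = 0 := by omega
  refine ⟨hv, Nat.eq_of_mul_eq_mul_left ℓ.n_pos ?_⟩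
  rw [← hw, weight, hv]
  ring

theorem weight_le_of_coeff_ne_zero (ℓ : Edge P) {e : ℕ}
    (h : MvPowerSeries.coeff (expo 0 e) P.p ≠ 0) : ℓ.weight ≤ ℓ.m * e := by
  rw [← fibre_zero] at h
  simpa [weight] using ℓ.supporting _ _ (coeff_series_ne_zero h)

/-- The polynomial `q_ℓ(1, s)` at the value `t` of `T`. -/
noncomputable def polyAt (ℓ : Edge P) (t : K) : Polynomial K := ℓ.poly.map (Polynomial.evalRingHom t)

theorem polyAt_eq_sum (ℓ : Edge P) (t : K) : ℓ.polyAt t =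
    ∑ k ∈ Finset.range (ℓ.d + 1), Polynomial.monomial k
      (MvPowerSeries.coeff (expo (ℓ.u + ℓ.m * (ℓ.d - k)) (ℓ.v + ℓ.n * k)) (P.fibre t)) := by
  simp [polyAt, poly, Polynomial.map_sum, coeff_fibre]

theorem coeff_poly (ℓ : Edge P) (k : ℕ) : ℓ.poly.coeff k = if k ≤ ℓ.d then
    MvPowerSeries.coeff (expo (ℓ.u + ℓ.m * (ℓ.d - k)) (ℓ.v + ℓ.n * k)) P.series else 0 := by
  simp [poly, Polynomial.coeff_monomial]

theorem eval_polyAt_eq_zero (ℓ : Edge P) {α : K} (h : ℓ.poly.eval (Polynomial.C α) = 0) (t : K) :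
    (ℓ.polyAt t).eval α = 0 := by
  have h1 := congrArg (Polynomial.evalRingHom t) h
  rw [← Polynomial.eval_map_apply] at h1
  simpa [polyAt] using h1

/-- The exponent of `y₁` in the pull-back of `P_ℓ` to the toric chart with exponents `a`, `b`. -/
def chartExponent (ℓ : Edge P) (a b : ℕ) : ℕ := a * ℓ.u + b * ℓ.v + a * ℓ.m * ℓ.d

theorem coeff_weight_subst_toricGerm (ℓ : Edge P) {a b : ℕ} (hab : b * ℓ.n = a * ℓ.m + 1)
    (α t : K) (s : ℕ) :
    MvPowerSeries.coeff (expo ℓ.weight s)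
      (MvPowerSeries.subst (toricGerm ℓ.n ℓ.m a b α) (P.fibre t)) =
      (Polynomial.taylor α (Polynomial.X ^ ℓ.chartExponent a b * ℓ.polyAt t)).coeff s := by
  classical
  let g : ℕ → (Fin 2 →₀ ℕ) := fun k => expo (ℓ.u + ℓ.m * (ℓ.d - k)) (ℓ.v + ℓ.n * k)
  have hg : Function.Injective g := by
    intro k k' h
    have h1 := (expo_inj.1 h).2
    exact Nat.eq_of_mul_eq_mul_left ℓ.n_pos (by omega)
  rw [coeff_subst_toricGerm ℓ.n_pos ℓ.m_pos, finsum_eq_sum_of_support_subset (s :=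
    (Finset.range (ℓ.d + 1)).image g), Finset.sum_image hg.injOn, Polynomial.taylor_mul,
    polyAt_eq_sum, map_sum, Finset.mul_sum, Polynomial.finsetSum_coeff]
  · refine Finset.sum_congr rfl fun k hk => ?_
    obtain ⟨r, hr⟩ := Nat.exists_eq_add_of_le (Nat.lt_succ_iff.1 (Finset.mem_range.1 hk))
    have h1 : ℓ.n * (g k) 0 + ℓ.m * (g k) 1 = ℓ.weight := by
      simp only [g, expo_apply_zero, expo_apply_one, weight]
      rw [hr, Nat.add_sub_cancel_left]
      ring
    have h2 : a * (g k) 0 + b * (g k) 1 = ℓ.chartExponent a b + k := by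
      simp only [g, expo_apply_zero, expo_apply_one, chartExponent]
      rw [hr, Nat.add_sub_cancel_left]
      -- The Bézout relation gives `b n k - a m k = k`: the `k`-th point of the edge contributes
      -- exactly `y₁ ^ k` beyond the common factor.
      linear_combination k * hab
    rw [if_pos h1, h2, Polynomial.taylor_monomial, ← mul_assoc, mul_comm _ (Polynomial.C _),
      mul_assoc, Polynomial.coeff_C_mul, Polynomial.taylor_pow, Polynomial.taylor_X, ← pow_add]
  · intro d hd
    rw [Function.mem_support] at hd
    have hf := left_ne_zero_of_mul hd
    have hw : ℓ.n * d 0 + ℓ.m * d 1 = ℓ.weight := by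
      by_contra h
      exact hd (by rw [if_neg h, mul_zero])
    rw [← expo_self d] at hf
    obtain ⟨k, hk, h0, h1⟩ := ℓ.exists_index (coeff_series_ne_zero hf) hw
    rw [Finset.coe_image]
    refine ⟨k, by simpa [Nat.lt_succ_iff] using hk, ?_⟩
    simp only [g]
    rw [← h0, ← h1, expo_self]

theorem coeff_subst_toricGerm_of_lt (ℓ : Edge P) (a b : ℕ) (α t : K) {r : ℕ} (hr : r < ℓ.weight)
    (s : ℕ) : MvPowerSeries.coeff (expo r s)
      (MvPowerSeries.subst (toricGerm ℓ.n ℓ.m a b α) (P.fibre t)) = 0 := by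
  rw [coeff_subst_toricGerm ℓ.n_pos ℓ.m_pos]
  refine finsum_eq_zero_of_forall_eq_zero fun d => ?_
  split_ifs with h
  · rw [mul_eq_zero]
    left
    by_contra hd
    rw [← expo_self d] at hd
    have := ℓ.supporting _ _ (coeff_series_ne_zero hd)
    rw [weight] at hr
    omega
  · rw [mul_zero]

/-- The edge is determined by the tuple `(n, m, u, v, d)`. -/
theorem ext_data {ℓ ℓ' : Edge P} (hn : ℓ.n = ℓ'.n) (hm : ℓ.m = ℓ'.m) (hu : ℓ.u = ℓ'.u)
    (hv : ℓ.v = ℓ'.v) (hd : ℓ.d = ℓ'.d) : ℓ = ℓ' := by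
  cases ℓ
  cases ℓ'
  simp only at hn hm hu hv hd
  subst hn hm hu hv hd
  rfl

/-- The support contains `(c, 0)` and some `(0, e)`. Comparing weights, the right end has abscissa
at most `c` and the left end has height at most `e`, which bounds all the data. -/
theorem finite (hP : P.IsSpecial) : Finite (Edge P) := by
  obtain ⟨e, he⟩ := hP.exists_coeff_ne_zero
  have h1 : ∀ ℓ : Edge P, ℓ.u + ℓ.m * ℓ.d ≤ P.c := by
    intro ℓ
    have h := ℓ.weight_le hP
    rw [weight] at h
    refine Nat.le_of_mul_le_mul_left (le_trans ?_ h) ℓ.n_pos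
    rw [mul_add, ← mul_assoc]
    omega
  have h2 : ∀ ℓ : Edge P, ℓ.v + ℓ.n * ℓ.d ≤ e := by
    intro ℓ
    have h := ℓ.weight_le_of_coeff_ne_zero he
    rw [weight] at h
    refine Nat.le_of_mul_le_mul_left (le_trans ?_ h) ℓ.m_pos
    rw [mul_add, ← mul_assoc, mul_comm ℓ.m ℓ.n]
    omega
  let N := P.c + e + 1
  let g : Edge P → Fin N × Fin N × Fin N × Fin N × Fin N := fun ℓ =>
    have h3 : ℓ.n ≤ ℓ.n * ℓ.d := Nat.le_mul_of_pos_right _ ℓ.d_pos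
    have h4 : ℓ.m ≤ ℓ.m * ℓ.d := Nat.le_mul_of_pos_right _ ℓ.d_pos
    have h5 : ℓ.d ≤ ℓ.m * ℓ.d := Nat.le_mul_of_pos_left _ ℓ.m_pos
    have h6 := h1 ℓ
    have h7 := h2 ℓ
    (⟨ℓ.n, by omega⟩, ⟨ℓ.m, by omega⟩, ⟨ℓ.u, by omega⟩, ⟨ℓ.v, by omega⟩, ⟨ℓ.d, by omega⟩)
  refine Finite.of_injective g fun ℓ ℓ' h => ?_
  simp only [g, Prod.mk.injEq, Fin.mk.injEq] at h
  exact ext_data h.1 h.2.1 h.2.2.1 h.2.2.2.1 h.2.2.2.2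

/-- The left end has abscissa less than `c`, so `T` does not occur there. Thus specializing `T`
never lowers the degree. -/
theorem leading_eq_C (hP : P.IsSpecial) (ℓ : Edge P) :
    ℓ.poly.coeff ℓ.d = Polynomial.C (MvPowerSeries.coeff (expo ℓ.u (ℓ.v + ℓ.n * ℓ.d)) P.p) ∧
      MvPowerSeries.coeff (expo ℓ.u (ℓ.v + ℓ.n * ℓ.d)) P.p ≠ 0 := by
  have hu : ℓ.u < P.c := by
    have h := ℓ.weight_le hP
    rw [weight] at h
    refine Nat.lt_of_mul_lt_mul_left (a := ℓ.n) (lt_of_lt_of_le ?_ h)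
    have := Nat.mul_pos (Nat.mul_pos ℓ.n_pos ℓ.m_pos) ℓ.d_pos
    omega
  have h := ℓ.left_mem
  rw [coeff_series_of_lt P hu] at h
  refine ⟨?_, fun h0 => h (by rw [h0, map_zero])⟩
  rw [coeff_poly, if_pos le_rfl, Nat.sub_self, mul_zero, add_zero, coeff_series_of_lt P hu]

theorem natDegree_polyAt (hP : P.IsSpecial) (ℓ : Edge P) (t : K) :
    (ℓ.polyAt t).natDegree = ℓ.d := by
  refine Polynomial.natDegree_eq_of_le_of_coeff_ne_zero ?_ ?_
  · rw [Polynomial.natDegree_le_iff_coeff_eq_zero]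
    intro k hk
    rw [polyAt, Polynomial.coeff_map, coeff_poly, if_neg (not_le.2 hk), map_zero]
  · rw [polyAt, Polynomial.coeff_map, (ℓ.leading_eq_C hP).1]
    simpa using (ℓ.leading_eq_C hP).2

theorem polyAt_ne_zero (hP : P.IsSpecial) (ℓ : Edge P) (t : K) : ℓ.polyAt t ≠ 0 := by
  intro h
  have := ℓ.natDegree_polyAt hP t
  rw [h, Polynomial.natDegree_zero] at this
  exact ℓ.d_pos.ne this

/-- The weight is less than `n c`, so no point of the edge reaches the abscissa `c` from which `T`
occurs. -/
theorem poly_eq_map_C (hP : P.IsSpecial) (ℓ : Edge P) (h : ¬ ℓ.IsDicritical) :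
    ℓ.poly = (ℓ.polyAt 0).map Polynomial.C := by
  ext1 k
  rw [Polynomial.coeff_map, polyAt, Polynomial.coeff_map, coeff_poly]
  split_ifs with hk
  · rw [coeff_series_of_lt]
    · simp
    · have h1 := ℓ.weight_lt hP h
      rw [weight] at h1
      refine Nat.lt_of_mul_lt_mul_left (a := ℓ.n) (lt_of_le_of_lt ?_ h1)
      rw [mul_add, ← mul_assoc]
      have := Nat.mul_le_mul_left (ℓ.n * ℓ.m) (Nat.sub_le ℓ.d k)
      omega
  · simp

theorem polyAt_zero_coeff_zero_ne_zero (hP : P.IsSpecial) (ℓ : Edge P) (h : ¬ ℓ.IsDicritical) :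
    (ℓ.polyAt 0).coeff 0 ≠ 0 := by
  intro h0
  have h1 := congrArg (fun f => Polynomial.coeff f 0) (ℓ.poly_eq_map_C hP h)
  simp only [Polynomial.coeff_map, h0, map_zero, coeff_poly] at h1
  exact ℓ.right_mem (by simpa using h1)

/-- Of the points of the edge only the end `(c, 0)`, with index `k = 0`, involves `T`. -/
theorem polyAt_eq_of_isDicritical (hP : P.IsSpecial) (ℓ : Edge P) (h : ℓ.IsDicritical) (t : K) :
    ℓ.polyAt t = Polynomial.C (MvPowerSeries.constantCoeff P.U) *
      (ℓ.dicriticalPoly - Polynomial.C t) := by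
  obtain ⟨hv, hc⟩ := h
  have hU := hP.constantCoeff_U_ne_zero
  have h1 : ℓ.polyAt t = ℓ.polyAt 0 - Polynomial.C (t * MvPowerSeries.constantCoeff P.U) := by
    ext k
    rw [Polynomial.coeff_sub, polyAt, polyAt, Polynomial.coeff_map, Polynomial.coeff_map,
      coeff_poly, Polynomial.coeff_C]
    rcases Nat.eq_zero_or_pos k with rfl | hk
    · rw [if_pos (Nat.zero_le _), if_pos rfl, hv, mul_zero, add_zero, Nat.sub_zero, hc,
        coeff_series_c]
      simp only [Polynomial.coe_evalRingHom, Polynomial.eval_sub, Polynomial.eval_mul,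
        Polynomial.eval_C, Polynomial.eval_X]
      ring
    · rw [if_neg hk.ne']
      split_ifs with hk'
      · rw [coeff_series_of_lt]
        · simp
        · rw [← hc]
          have := Nat.mul_lt_mul_of_pos_left (show ℓ.d - k < ℓ.d by have := ℓ.d_pos; omega) ℓ.m_pos
          omega
      · simp
  rw [h1, dicriticalPoly, mul_sub, ← mul_assoc, ← Polynomial.C_mul, mul_inv_cancel₀ hU,
    Polynomial.C_1, one_mul, mul_comm t, Polynomial.C_mul]
  rfl

theorem IsPower.eval_poly {ℓ : Edge P} {A : K} (h : ℓ.IsPower A) :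
    ℓ.poly.eval (Polynomial.C A) = 0 := by
  obtain ⟨-, -, -, β, hβ⟩ := h
  rw [hβ]
  simp [ℓ.d_pos.ne']

theorem IsPower.not_isDicritical (hP : P.IsSpecial) {ℓ : Edge P} {A : K} (h : ℓ.IsPower A) :
    ¬ ℓ.IsDicritical := by
  intro hd
  -- A root in `K` independent of `T` would give `q_E(A) = 0` and `q_E(A) = 1`.
  have h0 := ℓ.eval_polyAt_eq_zero h.eval_poly 0
  have h1 := ℓ.eval_polyAt_eq_zero h.eval_poly 1
  rw [ℓ.polyAt_eq_of_isDicritical hP hd] at h0 h1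
  simp only [Polynomial.eval_mul, Polynomial.eval_C, Polynomial.eval_sub, mul_eq_zero,
    hP.constantCoeff_U_ne_zero, false_or] at h0 h1
  exact one_ne_zero (by linear_combination h0 - h1 : (1 : K) = 0)

theorem finite_roots (hP : P.IsSpecial) (ℓ : Edge P) :
    Finite {α : K // ℓ.poly.eval (Polynomial.C α) = 0} := by
  have h : {α : K | ℓ.poly.eval (Polynomial.C α) = 0} ⊆ {α | (ℓ.polyAt 0).IsRoot α} :=
    fun α hα => ℓ.eval_polyAt_eq_zero hα 0
  exact ((Polynomial.finite_setOfPred_isRoot (ℓ.polyAt_ne_zero hP 0)).subset h).to_subtype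

/-- If a non-dicritical edge is not that of a power, the multiplicities of the roots of its
polynomial are less than the order in `y` of `p (0, y)`. -/
theorem rootMultiplicity_lt (hP : P.IsSpecial) (ℓ : Edge P) (h : ¬ ℓ.IsDicritical)
    (h' : ∀ A : K, ¬ ℓ.IsPower A) {e : ℕ} (he : MvPowerSeries.coeff (expo 0 e) P.p ≠ 0) (α : K) :
    (ℓ.polyAt 0).rootMultiplicity α < e := by
  by_contra! hle
  have h1 : (ℓ.polyAt 0).rootMultiplicity α ≤ ℓ.d := by
    rw [← ℓ.natDegree_polyAt hP 0]
    simpa using Polynomial.natDegree_le_of_dvd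
      (Polynomial.pow_rootMultiplicity_dvd (ℓ.polyAt 0) α) (ℓ.polyAt_ne_zero hP 0)
  have h2 := ℓ.weight_le_of_coeff_ne_zero he
  rw [weight] at h2
  have hn := ℓ.n_pos
  have hm := ℓ.m_pos
  have hd := ℓ.d_pos
  -- If the multiplicity `μ` were at least `e`, then `m e ≤ m μ ≤ m d ≤ n m d ≤ ω ≤ m e`. All are
  -- equalities, so `n = 1`, `u = v = 0` and `μ = d`: the edge is that of a power.
  have h3 : ℓ.m * e ≤ ℓ.m * ℓ.d := Nat.mul_le_mul_left _ (hle.trans h1)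
  have h4 : ℓ.m * ℓ.d ≤ ℓ.n * (ℓ.m * ℓ.d) := Nat.le_mul_of_pos_left _ hn
  rw [mul_assoc] at h2
  have hmd := Nat.mul_pos hm hd
  have hn1 : ℓ.n = 1 := Nat.eq_of_mul_eq_mul_right hmd (by omega)
  have hu : ℓ.u = 0 := (Nat.mul_eq_zero.1 (show ℓ.n * ℓ.u = 0 by omega)).resolve_left hn.ne'
  have hv : ℓ.v = 0 := (Nat.mul_eq_zero.1 (show ℓ.m * ℓ.v = 0 by omega)).resolve_left hm.ne'
  have hde : ℓ.d ≤ e := by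
    refine Nat.le_of_mul_le_mul_left ?_ hm
    omega
  obtain ⟨g, hg⟩ := Polynomial.pow_rootMultiplicity_dvd (ℓ.polyAt 0) α
  rw [show (ℓ.polyAt 0).rootMultiplicity α = ℓ.d by omega] at hg
  have hg0 : g ≠ 0 := by
    rintro rfl
    exact ℓ.polyAt_ne_zero hP 0 (by rw [hg, mul_zero])
  have hdeg := ℓ.natDegree_polyAt hP 0
  rw [hg, Polynomial.natDegree_mul (pow_ne_zero _ (Polynomial.X_sub_C_ne_zero α)) hg0,
    Polynomial.natDegree_pow, Polynomial.natDegree_X_sub_C, mul_one] at hdeg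
  rw [Polynomial.eq_C_of_natDegree_eq_zero (show g.natDegree = 0 by omega)] at hg
  refine h' α ⟨hn1, hu, hv, Polynomial.C (g.coeff 0), ?_⟩
  rw [ℓ.poly_eq_map_C hP h, hg, mul_comm]
  simp

end Edge

end Pencil

/-! ### Special pencils under translations and strict transforms. -/

namespace Pencil

variable {K : Type u} [Field K] {P : Pencil K}

theorem IsSpecial.translate (hP : P.IsSpecial) {m : ℕ} (hm : 0 < m) (A : K) :
    (P.translate m A).IsSpecial where
  c_pos := hP.c_pos
  isUnit_U := by
    rw [MvPowerSeries.isUnit_iff_constantCoeff, isUnit_iff_ne_zero,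
      ← MvPowerSeries.coeff_zero_eq_constantCoeff_apply, ← expo_zero_zero, Pencil.translate,
      coeff_zero_subst_shear hm, expo_zero_zero, MvPowerSeries.coeff_zero_eq_constantCoeff_apply]
    exact hP.constantCoeff_U_ne_zero
  not_dvd := by
    obtain ⟨e, he⟩ := hP.exists_coeff_ne_zero
    refine not_X_dvd (e := e) ?_
    rwa [Pencil.translate, coeff_zero_subst_shear hm]
  base_point := by
    rw [← MvPowerSeries.coeff_zero_eq_constantCoeff_apply, ← expo_zero_zero, Pencil.translate,
      coeff_zero_subst_shear hm, expo_zero_zero, MvPowerSeries.coeff_zero_eq_constantCoeff_apply,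
      hP.base_point]

/-- A translation that removes the edge of a power raises the order in `x` of `p (x, 0)`. -/
theorem coeff_translate_eq_zero {ℓ : Edge P} {A : K} (h : ℓ.IsPower A)
    {i : ℕ} (hi : i ≤ ℓ.m * ℓ.d) :
    MvPowerSeries.coeff (expo i 0) (P.translate ℓ.m A).p = 0 := by
  obtain ⟨hn, hu, hv, -⟩ := id h
  have hw : ℓ.weight = ℓ.m * ℓ.d := by simp [Edge.weight, hn, hu, hv]
  rw [Pencil.translate, coeff_subst_shear_zero ℓ.m_pos, ← hn, ← fibre_zero]
  rcases hi.lt_or_eq with hi | rfl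
  · exact ℓ.coeff_subst_toricGerm_of_lt _ _ _ _ (by rwa [hw]) _
  · rw [← hw, hn]
    have h1 := ℓ.coeff_weight_subst_toricGerm (a := 0) (b := 1) (by simp [hn]) A 0 0
    rw [hn] at h1
    rw [h1, Polynomial.taylor_coeff_zero, Polynomial.eval_mul,
      ℓ.eval_polyAt_eq_zero h.eval_poly, mul_zero]

section StrictTransform

variable (β : BezoutChoice) (ℓ : Edge P)

theorem coeff_strictTransform (α : K) (s : ℕ) :
    MvPowerSeries.coeff (expo 0 s) (P.strictTransform β ℓ α).p =
      (Polynomial.taylor α (Polynomial.X ^ ℓ.chartExponent (β.a ℓ.n ℓ.m) (β.b ℓ.n ℓ.m) *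
        ℓ.polyAt 0)).coeff s := by
  rw [← ℓ.coeff_weight_subst_toricGerm (β.bezout _ _ ℓ.n_pos ℓ.m_pos ℓ.coprime), fibre_zero]
  have h : expo ℓ.weight s = expo 0 s + expo ℓ.weight 0 := by
    rw [expo_add, zero_add, add_zero]
  rw [h]
  rfl

theorem root_ne_zero (hP : P.IsSpecial) (h : ¬ ℓ.IsDicritical) {α : K}
    (hα : ℓ.poly.eval (Polynomial.C α) = 0) : α ≠ 0 := by
  rintro rfl
  have h1 := ℓ.eval_polyAt_eq_zero hα 0
  rw [← Polynomial.coeff_zero_eq_eval_zero] at h1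
  exact ℓ.polyAt_zero_coeff_zero_ne_zero hP h h1

/-- The factor `y₁ ^ N` does not vanish at `α`, so the Taylor expansion at `α` starts in degree the
multiplicity of `α` in the edge polynomial. This is the order that drops in the induction. -/
theorem coeff_rootMultiplicity_strictTransform (hP : P.IsSpecial) {α : K} (hα : α ≠ 0) :
    MvPowerSeries.coeff (expo 0 ((ℓ.polyAt 0).rootMultiplicity α))
      (P.strictTransform β ℓ α).p ≠ 0 := by
  rw [coeff_strictTransform]
  set N := ℓ.chartExponent (β.a ℓ.n ℓ.m) (β.b ℓ.n ℓ.m)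
  have h0 : (Polynomial.X ^ N * ℓ.polyAt 0) ≠ 0 :=
    mul_ne_zero (pow_ne_zero _ Polynomial.X_ne_zero) (ℓ.polyAt_ne_zero hP 0)
  have h1 : (Polynomial.X ^ N * ℓ.polyAt 0).rootMultiplicity α =
      (ℓ.polyAt 0).rootMultiplicity α := by
    rw [Polynomial.rootMultiplicity_mul h0, Polynomial.rootMultiplicity_eq_zero, zero_add]
    simp [hα]
  rw [← h1, Polynomial.rootMultiplicity_eq_natTrailingDegree, ← Polynomial.taylor_apply,
    Polynomial.coeff_natTrailingDegree_ne_zero]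
  exact (Polynomial.taylor_eq_zero _ _).not.2 h0

theorem IsSpecial.strictTransform (hP : P.IsSpecial) (h : ¬ ℓ.IsDicritical) {α : K}
    (hα : ℓ.poly.eval (Polynomial.C α) = 0) : (P.strictTransform β ℓ α).IsSpecial where
  c_pos := Nat.sub_pos_of_lt (ℓ.weight_lt hP h)
  isUnit_U := by
    rw [MvPowerSeries.isUnit_iff_constantCoeff, isUnit_iff_ne_zero, Pencil.strictTransform, map_mul,
      constantCoeff_subst_toricGerm ℓ.n_pos ℓ.m_pos]
    refine mul_ne_zero ?_ hP.constantCoeff_U_ne_zero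
    simp [root_ne_zero ℓ hP h hα]
  not_dvd := not_X_dvd (coeff_rootMultiplicity_strictTransform β ℓ hP (root_ne_zero ℓ hP h hα))
  base_point := by
    rw [← MvPowerSeries.coeff_zero_eq_constantCoeff_apply, ← expo_zero_zero, coeff_strictTransform,
      Polynomial.taylor_coeff_zero, Polynomial.eval_mul, ℓ.eval_polyAt_eq_zero hα, mul_zero]

end StrictTransform

/-! ### Finiteness of the set of dicriticals. -/

namespace Dicritical

variable {β : BezoutChoice}

theorem pencil_isSpecial (hP : P.IsSpecial) (E : Dicritical β P) : E.pencil.IsSpecial := by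
  induction E with
  | here ℓ h => exact hP
  | afterTranslation ℓ A h E ih => exact ih (hP.translate ℓ.m_pos A)
  | afterToric ℓ h h' α hα E ih => exact ih (hP.strictTransform β ℓ h hα)

theorem edge_isDicritical (E : Dicritical β P) : E.edge.IsDicritical := by
  induction E with
  | here ℓ h => exact h
  | afterTranslation ℓ A h E ih => exact ih
  | afterToric ℓ h h' α hα E ih => exact ih

/-- A node has finitely many edges, each with finitely many roots, and the `A` of a power is such a
root; so the node has finitely many children. -/
theorem finite_of_children (hP : P.IsSpecial)
    (h₁ : ∀ (ℓ : Edge P) (A : K), ℓ.IsPower A → Finite (Dicritical β (P.translate ℓ.m A)))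
    (h₂ : ∀ (ℓ : Edge P) (α : K), ¬ ℓ.IsDicritical → (∀ A : K, ¬ ℓ.IsPower A) →
      ℓ.poly.eval (Polynomial.C α) = 0 → Finite (Dicritical β (P.strictTransform β ℓ α))) :
    Finite (Dicritical β P) := by
  have := Edge.finite hP
  have hr := fun ℓ : Edge P => ℓ.finite_roots hP
  let I₁ := Σ ℓ : Edge P, {A : K // ℓ.IsPower A}
  let I₂ := Σ ℓ : Edge P, {α : K // ¬ ℓ.IsDicritical ∧ (∀ A : K, ¬ ℓ.IsPower A) ∧
    ℓ.poly.eval (Polynomial.C α) = 0}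
  have hI₁ : ∀ ℓ : Edge P, Finite {A : K // ℓ.IsPower A} := fun ℓ =>
    Finite.of_injective
      (fun A => (⟨A.1, A.2.eval_poly⟩ : {α : K // ℓ.poly.eval (Polynomial.C α) = 0}))
      fun A A' h => Subtype.ext (Subtype.mk.inj h)
  have hI₂ : ∀ ℓ : Edge P, Finite {α : K // ¬ ℓ.IsDicritical ∧ (∀ A : K, ¬ ℓ.IsPower A) ∧
      ℓ.poly.eval (Polynomial.C α) = 0} := fun ℓ =>
    Finite.of_injective
      (fun A => (⟨A.1, A.2.2.2⟩ : {α : K // ℓ.poly.eval (Polynomial.C α) = 0}))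
      fun A A' h => Subtype.ext (Subtype.mk.inj h)
  have hD₁ : ∀ x : I₁, Finite (Dicritical β (P.translate x.1.m x.2.1)) :=
    fun x => h₁ x.1 x.2.1 x.2.2
  have hD₂ : ∀ x : I₂, Finite (Dicritical β (P.strictTransform β x.1 x.2.1)) :=
    fun x => h₂ x.1 x.2.1 x.2.2.1 x.2.2.2.1 x.2.2.2.2
  let g : {ℓ : Edge P // ℓ.IsDicritical} ⊕
      ((Σ x : I₁, Dicritical β (P.translate x.1.m x.2.1)) ⊕
        (Σ x : I₂, Dicritical β (P.strictTransform β x.1 x.2.1))) → Dicritical β P := fun y =>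
    match y with
    | .inl ℓ => .here ℓ.1 ℓ.2
    | .inr (.inl ⟨x, E⟩) => .afterTranslation x.1 x.2.1 x.2.2 E
    | .inr (.inr ⟨x, E⟩) => .afterToric x.1 x.2.2.1 x.2.2.2.1 x.2.1 x.2.2.2.2 E
  refine Finite.of_surjective g fun E => ?_
  cases E with
  | here ℓ h => exact ⟨.inl ⟨ℓ, h⟩, rfl⟩
  | afterTranslation ℓ A h E => exact ⟨.inr (.inl ⟨⟨ℓ, A, h⟩, E⟩), rfl⟩
  | afterToric ℓ h h' α hα E => exact ⟨.inr (.inr ⟨⟨ℓ, α, h, h', hα⟩, E⟩), rfl⟩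

theorem finite (hP : P.IsSpecial) : Finite (Dicritical β P) := by
  -- Here `e` bounds the order of `p(0, y)`, and `r` bounds the gap between `c` and the order of
  -- `p(x, 0)`. The induction is lexicographic in `(e, r)`.
  suffices H : ∀ (e r : ℕ) (P : Pencil K), P.IsSpecial →
      MvPowerSeries.coeff (expo 0 e) P.p ≠ 0 →
      (∀ i, i + r < P.c → MvPowerSeries.coeff (expo i 0) P.p = 0) → Finite (Dicritical β P) by
    obtain ⟨e, he⟩ := hP.exists_coeff_ne_zero
    exact H e P.c P hP he fun i hi => by omega
  intro e
  induction e using Nat.strong_induction_on with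
  | _ e ihe =>
  intro r
  induction r using Nat.strong_induction_on with
  | _ r ihr =>
  intro P hP he hr
  refine finite_of_children hP (fun ℓ A h => ?_) fun ℓ α h h' hα => ?_
  · obtain ⟨hn, hu, hv, -⟩ := id h
    have hlt : ℓ.m * ℓ.d < P.c := by
      simpa [Edge.weight, hn, hu, hv] using ℓ.weight_lt hP (h.not_isDicritical hP)
    -- The right end `(m d, 0)` of the edge is a monomial of `p`, so it cannot lie in the range
    -- where `p(x, 0)` vanishes.
    have hle : P.c ≤ ℓ.m * ℓ.d + r := by
      by_contra! hlt'
      have h1 := ℓ.right_mem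
      rw [hu, hv, zero_add, coeff_series_of_lt P hlt, hr _ hlt', map_zero] at h1
      exact h1 rfl
    -- After the translation the coefficients of `p(x, 0)` vanish up to and including degree `m d`;
    -- the `- 1` records the inclusive bound and makes `r` drop.
    refine ihr (P.c - ℓ.m * ℓ.d - 1) (by omega) _ (hP.translate ℓ.m_pos A) ?_ fun i hi => ?_
    · rwa [Pencil.translate, coeff_zero_subst_shear ℓ.m_pos]
    · have hi : i + (P.c - ℓ.m * ℓ.d - 1) < P.c := hi
      exact coeff_translate_eq_zero h (by omega)
  · have hP' := hP.strictTransform β ℓ h hα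
    -- As `e` drops, `r` may be reset to the new `c`, for which the vanishing condition is empty.
    exact ihe _ (ℓ.rootMultiplicity_lt hP h h' he α) (P.strictTransform β ℓ α).c _ hP'
      (coeff_rootMultiplicity_strictTransform β ℓ hP (root_ne_zero ℓ hP h hα))
      fun i hi => by omega

/-! ### Typical values in terms of the roots of `q_E - t`. -/

section Typical

variable (E : Dicritical β P)

theorem chart_bezout : E.chartB * E.edge.n = E.chartA * E.edge.m + 1 := by
  rw [chartA, chartB]
  split_ifs with h
  · simp [h]
  · exact β.bezout _ _ E.edge.n_pos E.edge.m_pos E.edge.coprime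

theorem chartA_eq_zero_iff : E.chartA = 0 ↔ E.vRatio = 1 := by
  refine ⟨fun h => ?_, fun h => if_pos h⟩
  have h1 := E.chart_bezout
  rw [h, zero_mul, zero_add] at h1
  exact Nat.eq_one_of_mul_eq_one_left h1

theorem isFreePoint_iff (α : K) : E.IsFreePoint α ↔ α ≠ 0 ∨ E.vRatio = 1 := by
  rw [IsFreePoint, chartA_eq_zero_iff]

/-- This is the edge formula in the chart of `E`, where `v = 0` and `u + m d = c` reduce the
exponent of `y₁` to `a c`. -/
theorem coeff_germ (hP : P.IsSpecial) (t α : K) (s : ℕ) :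
    MvPowerSeries.coeff (expo 0 s) (E.germ t α) =
      MvPowerSeries.constantCoeff E.pencil.U * (Polynomial.taylor α
        (Polynomial.X ^ (E.chartA * E.pencil.c) * (E.q - Polynomial.C t))).coeff s := by
  have h : expo E.edge.weight s = expo 0 s + expo E.edge.weight 0 := by
    rw [expo_add, zero_add, add_zero]
  have h1 := E.edge.coeff_weight_subst_toricGerm E.chart_bezout α t s
  have hN : E.edge.chartExponent E.chartA E.chartB = E.chartA * E.pencil.c := by
    rw [Edge.chartExponent, E.edge_isDicritical.1, ← E.edge_isDicritical.2]
    ring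
  rw [h, E.edge.polyAt_eq_of_isDicritical (E.pencil_isSpecial hP) E.edge_isDicritical, hN,
    mul_left_comm, Polynomial.taylor_mul, Polynomial.taylor_C, Polynomial.coeff_C_mul] at h1
  exact h1

theorem pow_ne_zero_of_isFreePoint {α : K} (h : E.IsFreePoint α) :
    α ^ (E.chartA * E.pencil.c) ≠ 0 := by
  rcases h with h | h
  · exact pow_ne_zero _ h
  · simp [h]

theorem passesThrough_germ_iff (hP : P.IsSpecial) {t α : K} (h : E.IsFreePoint α) :
    PassesThrough (E.germ t α) ↔ E.q.eval α = t := by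
  rw [PassesThrough, ← MvPowerSeries.coeff_zero_eq_constantCoeff_apply, ← expo_zero_zero,
    coeff_germ E hP, Polynomial.taylor_coeff_zero]
  simp [(E.pencil_isSpecial hP).constantCoeff_U_ne_zero, E.pow_ne_zero_of_isFreePoint h,
    sub_eq_zero, -pow_eq_zero_iff, -mul_eq_zero, mul_eq_zero_iff_left]

theorem isCurvette_germ_iff (hP : P.IsSpecial) {t α : K} (h : E.IsFreePoint α)
    (h' : E.q.eval α = t) :
    IsCurvette (E.germ t α) ↔ (Polynomial.derivative E.q).eval α ≠ 0 := by
  rw [IsCurvette, and_iff_right ((E.passesThrough_germ_iff hP h).2 h'), coeff_germ E hP,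
    Polynomial.taylor_coeff_one, Polynomial.derivative_mul, Polynomial.eval_add,
    Polynomial.eval_mul, Polynomial.eval_sub, h', Polynomial.eval_C, sub_self, mul_zero, zero_add,
    Polynomial.derivative_sub, Polynomial.derivative_C, sub_zero, Polynomial.eval_mul,
    Polynomial.eval_pow, Polynomial.eval_X, not_iff_not,
    mul_eq_zero_iff_left (E.pencil_isSpecial hP).constantCoeff_U_ne_zero,
    mul_eq_zero_iff_left (E.pow_ne_zero_of_isFreePoint h)]

theorem isTypical_iff_encard (hP : P.IsSpecial) (t : K) : E.IsTypical t ↔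
    (∀ α : K, E.IsFreePoint α → E.q.eval α = t → (Polynomial.derivative E.q).eval α ≠ 0) ∧
      {α : K | E.IsFreePoint α ∧ E.q.eval α = t}.encard = E.degree := by
  rw [IsTypical]
  refine and_congr (forall₂_congr fun α h => ?_) ?_
  · rw [E.passesThrough_germ_iff hP h]
    exact forall_congr' fun h' => E.isCurvette_germ_iff hP h h'
  · have h : {α : K | E.IsFreePoint α ∧ PassesThrough (E.germ t α)} =
        {α : K | E.IsFreePoint α ∧ E.q.eval α = t} := by
      ext α
      exact and_congr_right fun h => E.passesThrough_germ_iff hP h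
    rw [h]

theorem natDegree_q_sub_C (hP : P.IsSpecial) (t : K) :
    (E.q - Polynomial.C t).natDegree = E.degree := by
  have hs := E.pencil_isSpecial hP
  rw [degree, ← E.edge.natDegree_polyAt hs t,
    E.edge.polyAt_eq_of_isDicritical hs E.edge_isDicritical,
    Polynomial.natDegree_C_mul hs.constantCoeff_U_ne_zero]
  rfl

/-- There are at most `d_E` distinct roots of `q_E - t`, so `d_E` free ones exhaust them.
Conversely, if no root is critical, the `d_E` roots counted with multiplicity are distinct. -/
theorem isTypical_iff [IsAlgClosed K] (hP : P.IsSpecial) (t : K) : E.IsTypical t ↔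
    (∀ α : K, E.q.eval α = t → E.IsFreePoint α ∧ (Polynomial.derivative E.q).eval α ≠ 0) := by
  classical
  set f := E.q - Polynomial.C t with hf
  have hdeg : f.natDegree = E.degree := E.natDegree_q_sub_C hP t
  have hf0 : f ≠ 0 := by
    intro h
    rw [h, Polynomial.natDegree_zero] at hdeg
    exact E.edge.d_pos.ne hdeg
  have hroot : ∀ α : K, α ∈ f.roots ↔ E.q.eval α = t := by
    intro α
    rw [Polynomial.mem_roots hf0, Polynomial.IsRoot, hf, Polynomial.eval_sub, Polynomial.eval_C,
      sub_eq_zero]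
  have hder : Polynomial.derivative f = Polynomial.derivative E.q := by
    rw [hf, Polynomial.derivative_sub, Polynomial.derivative_C, sub_zero]
  have hcard : f.roots.card = E.degree := by
    rw [← hdeg]
    exact (IsAlgClosed.splits f).natDegree_eq_card_roots.symm
  have hset : {α : K | E.q.eval α = t} = (f.roots.toFinset : Set K) := by
    ext α
    simp [hroot, -Polynomial.mem_roots']
  rw [E.isTypical_iff_encard hP]
  constructor
  · rintro ⟨h1, h2⟩ α hα
    have hsub : {α : K | E.IsFreePoint α ∧ E.q.eval α = t} ⊆ {α : K | E.q.eval α = t} :=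
      fun _ h => h.2
    have heq : {α : K | E.IsFreePoint α ∧ E.q.eval α = t} = {α : K | E.q.eval α = t} := by
      refine Set.Finite.eq_of_subset_of_encard_le ?_ hsub ?_
      · exact (hset ▸ Finset.finite_toSet _ : {α : K | E.q.eval α = t}.Finite).subset hsub
      · rw [h2, hset, Set.encard_coe_eq_coe_finsetCard, ← hcard]
        exact_mod_cast Multiset.toFinset_card_le _
    have hα' : α ∈ {α : K | E.IsFreePoint α ∧ E.q.eval α = t} := heq ▸ hα
    exact ⟨hα'.1, h1 α hα'.1 hα⟩
  · intro h
    refine ⟨fun α _ hα => (h α hα).2, ?_⟩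
    have heq : {α : K | E.IsFreePoint α ∧ E.q.eval α = t} = {α : K | E.q.eval α = t} := by
      ext α
      exact ⟨fun h' => h'.2, fun h' => ⟨(h α h').1, h'⟩⟩
    have hnodup : f.roots.Nodup := by
      rw [Multiset.nodup_iff_count_le_one]
      intro α
      rw [Polynomial.count_roots]
      by_contra! hlt
      have h1 := (Polynomial.one_lt_rootMultiplicity_iff_isRoot hf0).1 hlt
      rw [hder] at h1
      exact (h α ((hroot α).1 ((Polynomial.mem_roots hf0).2 h1.1))).2 h1.2
    rw [heq, hset, Set.encard_coe_eq_coe_finsetCard, Multiset.toFinset_card_of_nodup hnodup, hcard]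

theorem atypicalValues_of_one_lt [IsAlgClosed K] (hP : P.IsSpecial) (h : 1 < E.vRatio) :
    E.atypicalValues = E.criticalValues ∪ {E.q.eval 0} := by
  ext t
  rw [atypicalValues, Set.mem_ofPred_eq, E.isTypical_iff hP]
  simp only [isFreePoint_iff, h.ne', or_false, criticalValues, Set.mem_union, Set.mem_ofPred_eq,
    Set.mem_singleton_iff]
  constructor
  · intro h1
    push Not at h1
    obtain ⟨α, hα, h2⟩ := h1
    by_cases h0 : α = 0
    · right
      rw [← hα, h0]
    · exact Or.inl ⟨α, h2 h0, hα⟩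
  · rintro (⟨α, h1, h2⟩ | rfl) h3
    · exact (h3 α h2).2 h1
    · exact (h3 0 rfl).1 rfl

theorem atypicalValues_of_eq_one [IsAlgClosed K] (hP : P.IsSpecial) (h : E.vRatio = 1) :
    E.atypicalValues = E.criticalValues := by
  ext t
  rw [atypicalValues, Set.mem_ofPred_eq, E.isTypical_iff hP]
  simp only [isFreePoint_iff, h, or_true, true_and, criticalValues, Set.mem_ofPred_eq]
  push Not
  exact exists_congr fun α => and_comm

/-- If `0` is a critical point its value is `q_E(0)`, so for every v-ratio this value and those at
non-zero critical points suffice. -/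
theorem encard_atypicalValues_le [IsAlgClosed K] (hP : P.IsSpecial) :
    E.atypicalValues.encard ≤ E.bound := by
  have h1 : E.atypicalValues ⊆ insert (E.q.eval 0) ((fun α => E.q.eval α) ''
      {α : K | α ≠ 0 ∧ (Polynomial.derivative E.q).eval α = 0}) := by
    have h2 : E.criticalValues ⊆ insert (E.q.eval 0) ((fun α => E.q.eval α) ''
        {α : K | α ≠ 0 ∧ (Polynomial.derivative E.q).eval α = 0}) := by
      rintro t ⟨α, hα, rfl⟩
      by_cases h0 : α = 0
      · exact Or.inl (by rw [h0])
      · exact Or.inr ⟨α, ⟨h0, hα⟩, rfl⟩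
    rcases (Nat.succ_le_of_lt E.edge.n_pos).eq_or_lt with h | h
    · rwa [E.atypicalValues_of_eq_one hP h.symm]
    · rw [E.atypicalValues_of_one_lt hP h]
      exact Set.union_subset h2 (Set.singleton_subset_iff.2 (Set.mem_insert _ _))
  refine (Set.encard_le_encard h1).trans ((Set.encard_insert_le _ _).trans ?_)
  exact add_le_add (Set.encard_image_le _ _) le_rfl

end Typical

end Dicritical

end Pencil

theorem mainTheorem1 {K : Type u} [Field K] [IsAlgClosed K] (β : BezoutChoice) (P : Pencil K)
    (hP : P.IsSpecial)
    (hsep : ∀ E : Pencil.Dicritical β P, Polynomial.derivative E.q ≠ 0) :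
    (∀ E : Pencil.Dicritical β P,
      (1 < E.vRatio → E.atypicalValues = E.criticalValues ∪ {E.q.eval 0}) ∧
      (E.vRatio = 1 → E.atypicalValues = E.criticalValues) ∧
      E.atypicalValues.encard ≤ E.bound) ∧
    ∃ _ : Fintype (Pencil.Dicritical β P),
      (P.atypicalValues β).encard ≤ ∑ E : Pencil.Dicritical β P, E.bound := by
  refine ⟨fun E => ⟨E.atypicalValues_of_one_lt hP, E.atypicalValues_of_eq_one hP,
    E.encard_atypicalValues_le hP⟩, ?_⟩
  have := Pencil.Dicritical.finite (β := β) hP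
  have := Fintype.ofFinite (Pencil.Dicritical β P)
  refine ⟨this, ?_⟩
  have h : P.atypicalValues β = ⋃ E : Pencil.Dicritical β P, E.atypicalValues := by
    ext t
    simp [Pencil.atypicalValues, Pencil.Dicritical.atypicalValues]
  rw [h]
  exact (Set.encard_iUnion_le_of_fintype _).trans
    (Finset.sum_le_sum fun E _ => E.encard_atypicalValues_le hP)
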